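/- Let $\nu\in\mathbb{R}\setminus\{0,-1,-2,\dots\}$ and, for $n\in\mathbb{N}$, let $L_n(\nu)$ denote the real symmetric $n\times n$ matrix (the generalized Hilbert $L$-matrix) with entries \[ (L_n(\nu))_{i,j}=\frac{1}{\max(i,j)+\nu},\qquad i,j\in\{0,1,\dots,n-1\}. \] Write $\sigma(L_n(\nu))$ for its set of eigenvalues and $\#S$ for the cardinality of a set $S$. Then, for every $x\in(0,1)$, \[ \lim_{n\to\infty}\frac{\#\{\mu\in\sigma(L_n(\nu)) \mid 4x<\mu<4\}}{\log n}=\frac{1}{2\pi}\sqrt{\frac{1-x}{x}}. \] -/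

import Mathlib

open Filter Topology

/-- The generalized Hilbert `L`-matrix `L_n(ν)` of size `n × n`, with entries
`1 / (max(i, j) + ν)` for `i, j ∈ {0, …, n - 1}`. -/
noncomputable def hilbertLMatrix (n : ℕ) (ν : ℝ) : Matrix (Fin n) (Fin n) ℝ :=
  Matrix.of fun i j => 1 / (max ((i : ℕ) : ℝ) ((j : ℕ) : ℝ) + ν)

/-! Write a vector as the increments of a sequence P with P_0 = P_n = 0. Summation by parts makes
the form of L_n(ν) diagonal in P, with weights 1/(i+ν) - 1/(i+1+ν) ~ 1/i², while ‖v‖² = ∑(ΔP)².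
Counting eigenvalues above μ thus becomes a discrete Hardy-type problem: how often does an equation
with potential about 1/(μi²) oscillate?

The comparison solutions are u_i = √i sin θ_i, whose potential is asymptotic to (s²+1/4)/i² and
whose phase satisfies θ_n ~ s log n, giving about (s/π) log n sign changes. Setting P = uφ in
Picone's identity, `card_eigenvalues_gt_le` and `le_card_eigenvalues_gt` bound the eigenvalue count
from both sides by the number of sign changes, up to a constant. The critical s solves μ(s²+1/4) =
1; for μ = 4x it is ½√((1-x)/x). Letting s → 0 shows that only o(log n) eigenvalues are ≥ 4.
Positive eigenvalues are simple, so counting them as a set loses nothing. -/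

/-! ### Min-max bounds for eigenvalue counts -/

section EigenvalueCount

variable {ι : Type*} [Fintype ι] [DecidableEq ι] {A : Matrix ι ι ℝ}

/-- The coordinates of a vector with respect to the eigenvector basis of a symmetric matrix. -/
noncomputable def eigenCoords (hA : A.IsHermitian) : (ι → ℝ) ≃ₗ[ℝ] (ι → ℝ) :=
  (WithLp.linearEquiv 2 ℝ (ι → ℝ)).symm ≪≫ₗ hA.eigenvectorBasis.repr.toLinearEquiv ≪≫ₗ
    WithLp.linearEquiv 2 ℝ (ι → ℝ)

theorem dotProduct_eigenCoords (hA : A.IsHermitian) (v w : ι → ℝ) :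
    eigenCoords hA v ⬝ᵥ eigenCoords hA w = v ⬝ᵥ w := by
  exact hA.eigenvectorBasis.repr.inner_map_map (WithLp.toLp 2 w) (WithLp.toLp 2 v)

theorem eigenCoords_mulVec (hA : A.IsHermitian) (v : ι → ℝ) (i : ι) :
    eigenCoords hA (A.mulVec v) i = hA.eigenvalues i * eigenCoords hA v i := by
  have key : ∀ w : ι → ℝ, eigenCoords hA w i = (hA.eigenvectorBasis i).ofLp ⬝ᵥ w := by
    intro w
    simp [eigenCoords, OrthonormalBasis.repr_apply_apply,
      EuclideanSpace.inner_eq_star_dotProduct, dotProduct_comm]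
  rw [key, key, Matrix.dotProduct_mulVec, ← Matrix.mulVec_transpose,
    show A.transpose = A from hA.eq,
    hA.mulVec_eigenvectorBasis, smul_dotProduct, smul_eq_mul]

theorem dotProduct_mulVec_eq_sum_eigenvalues (hA : A.IsHermitian) (v : ι → ℝ) :
    v ⬝ᵥ A.mulVec v = ∑ i, hA.eigenvalues i * eigenCoords hA v i ^ 2 := by
  rw [← dotProduct_eigenCoords hA, dotProduct]
  refine Finset.sum_congr rfl fun i _ => ?_
  rw [eigenCoords_mulVec]; ring

theorem dotProduct_self_eq_sum_eigenCoords (hA : A.IsHermitian) (v : ι → ℝ) :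
    v ⬝ᵥ v = ∑ i, eigenCoords hA v i ^ 2 := by
  rw [← dotProduct_eigenCoords hA, dotProduct]
  exact Finset.sum_congr rfl fun i _ => (sq _).symm

/-- If the quadratic form exceeds `μ ‖·‖²` on a space of dimension `k`, then at least `k`
eigenvalues exceed `μ`. -/
theorem card_le_card_eigenvalues_gt (hA : A.IsHermitian) (μ : ℝ) {K : Type*} [Fintype K]
    (T : (K → ℝ) →ₗ[ℝ] (ι → ℝ)) (hT : ∀ c, c ≠ 0 → μ * (T c ⬝ᵥ T c) < T c ⬝ᵥ A.mulVec (T c)) :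
    Fintype.card K ≤ Fintype.card {i // μ < hA.eigenvalues i} := by
  let G : (K → ℝ) →ₗ[ℝ] ({i // μ < hA.eigenvalues i} → ℝ) :=
    LinearMap.funLeft ℝ ℝ Subtype.val ∘ₗ (eigenCoords hA).toLinearMap ∘ₗ T
  have hG : Function.Injective G := by
    rw [injective_iff_map_eq_zero]
    intro c hc
    by_contra hne
    have h := hT c hne
    rw [dotProduct_self_eq_sum_eigenCoords hA, dotProduct_mulVec_eq_sum_eigenvalues hA,
      Finset.mul_sum] at h
    refine absurd h (not_lt.2 (Finset.sum_le_sum fun i _ => ?_))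
    by_cases hi : μ < hA.eigenvalues i
    · have : eigenCoords hA (T c) i = 0 := congrFun hc ⟨i, hi⟩
      simp [this]
    · exact mul_le_mul_of_nonneg_right (not_lt.1 hi) (sq_nonneg _)
  simpa using LinearMap.finrank_le_finrank_of_injective hG

/-- If the quadratic form is at most `μ ‖·‖²` on a space of codimension `k`, then at most `k`
eigenvalues exceed `μ`. -/
theorem card_eigenvalues_gt_le_card (hA : A.IsHermitian) (μ : ℝ) {J : Type*} [Fintype J]
    (F : (ι → ℝ) →ₗ[ℝ] (J → ℝ)) (hF : ∀ v, F v = 0 → v ⬝ᵥ A.mulVec v ≤ μ * (v ⬝ᵥ v)) :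
    Fintype.card {i // μ < hA.eigenvalues i} ≤ Fintype.card J := by
  -- The span of the eigenvectors above μ meets the kernel of F only in 0, since the form strictly
  -- exceeds μ‖·‖² on its nonzero vectors.
  let G : ({i // μ < hA.eigenvalues i} → ℝ) →ₗ[ℝ] (J → ℝ) :=
    F ∘ₗ (eigenCoords hA).symm.toLinearMap ∘ₗ Function.ExtendByZero.linearMap ℝ Subtype.val
  have hG : Function.Injective G := by
    rw [injective_iff_map_eq_zero]
    intro c hc
    have h := hF _ hc
    rw [dotProduct_self_eq_sum_eigenCoords hA, dotProduct_mulVec_eq_sum_eigenvalues hA,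
      Finset.mul_sum] at h
    simp only [LinearEquiv.coe_coe, LinearEquiv.apply_symm_apply, LinearMap.comp_apply] at h
    set d : ι → ℝ := Function.ExtendByZero.linearMap ℝ Subtype.val c with hd
    have hval : ∀ i : {i // μ < hA.eigenvalues i}, d i = c i := fun i =>
      Subtype.val_injective.extend_apply _ _ _
    have hle : ∀ i ∈ Finset.univ, μ * d i ^ 2 ≤ hA.eigenvalues i * d i ^ 2 := by
      intro i _
      by_cases hi : μ < hA.eigenvalues i
      · exact mul_le_mul_of_nonneg_right hi.le (sq_nonneg _)
      · have : d i = 0 := Function.extend_apply' _ _ _ (by rintro ⟨a, rfl⟩; exact hi a.2)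
        simp [this]
    have heq := (Finset.sum_eq_sum_iff_of_le hle).1 (le_antisymm (Finset.sum_le_sum hle) h)
    ext i
    have hi := heq i (Finset.mem_univ _)
    rw [hval] at hi
    have hz : (hA.eigenvalues i - μ) * c i ^ 2 = 0 := by linarith
    simpa [sub_ne_zero.2 i.2.ne'] using hz
  simpa using LinearMap.finrank_le_finrank_of_injective hG

end EigenvalueCount

/-! ### Simplicity of the positive eigenvalues -/

theorem hilbertLMatrix_isHermitian (n : ℕ) (ν : ℝ) : (hilbertLMatrix n ν).IsHermitian := by
  ext i j
  simp [hilbertLMatrix, max_comm]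

/-- An eigenvector of the `L`-matrix for a nonzero eigenvalue is determined by its first entry. -/
theorem eq_zero_of_hilbertLMatrix_mulVec {n : ℕ} {ν μ : ℝ} (hμ : μ ≠ 0) {v : Fin (n + 1) → ℝ}
    (hv : (hilbertLMatrix (n + 1) ν).mulVec v = μ • v) (h0 : v 0 = 0) : v = 0 := by
  have key : ∀ k : ℕ, ∀ i : Fin (n + 1), (i : ℕ) ≤ k → v i = 0 := by
    intro k
    induction k with
    | zero =>
      intro i hi
      rwa [show i = 0 from Fin.ext (by simpa using hi)]
    | succ k ih =>
      intro i hi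
      rcases Nat.lt_or_ge k i with hki | hki
      · have hik : (i : ℕ) = k + 1 := by omega
        let i' : Fin (n + 1) := ⟨k, by omega⟩
        have h1 := congrFun hv i
        have h2 := congrFun hv i'
        -- Rows k and k+1 agree in the columns beyond k, and v vanishes in the others.
        have h3 : (hilbertLMatrix (n + 1) ν).mulVec v i = (hilbertLMatrix (n + 1) ν).mulVec v i' := by
          simp only [Matrix.mulVec, dotProduct, hilbertLMatrix, Matrix.of_apply]
          refine Finset.sum_congr rfl fun j _ => ?_
          rcases Nat.lt_or_ge k j with hj | hj
          · have hj1 : ((i : ℕ) : ℝ) ≤ ((j : ℕ) : ℝ) := by exact_mod_cast (by omega : (i : ℕ) ≤ j)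
            have hj2 : ((i' : ℕ) : ℝ) ≤ ((j : ℕ) : ℝ) := by exact_mod_cast hj.le
            rw [max_eq_right hj1, max_eq_right hj2]
          · simp [ih j hj]
        have h4 : v i' = 0 := ih i' le_rfl
        rw [h3, h2] at h1
        simpa [h4, hμ] using h1
      · exact ih i hki
  ext i
  exact key n i (by omega)

theorem hilbertLMatrix_eigenvalues_injOn (n : ℕ) (ν : ℝ) :
    Set.InjOn (hilbertLMatrix_isHermitian n ν).eigenvalues
      {i | 0 < (hilbertLMatrix_isHermitian n ν).eigenvalues i} := by
  intro i hi j _ hij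
  by_contra hne
  obtain _ | n := n
  · exact i.elim0
  set hA := hilbertLMatrix_isHermitian (n + 1) ν
  set x := hA.eigenvectorBasis i
  set y := hA.eigenvectorBasis j
  have hi0 : hA.eigenvalues i ≠ 0 := ne_of_gt hi
  have hz : x.ofLp 0 = 0 := by
    -- This combination of the two eigenvectors has first entry 0, so it vanishes; pairing with y
    -- gives x 0 = 0.
    have h := eq_zero_of_hilbertLMatrix_mulVec hi0
      (v := y.ofLp 0 • x.ofLp - x.ofLp 0 • y.ofLp) (ν := ν) (by
        rw [Matrix.mulVec_sub, Matrix.mulVec_smul, Matrix.mulVec_smul,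
          hA.mulVec_eigenvectorBasis, hA.mulVec_eigenvectorBasis, ← hij]
        module) (by simp [mul_comm])
    have h' : y.ofLp 0 • x - x.ofLp 0 • y = 0 := (WithLp.equiv 2 _).injective h
    have h2 := congrArg (inner ℝ y) h'
    have hxy : inner ℝ y x = 0 := hA.eigenvectorBasis.orthonormal.2 (Ne.symm hne)
    have hy0 : y ≠ 0 := hA.eigenvectorBasis.orthonormal.ne_zero j
    simpa [inner_sub_right, inner_smul_right, hxy, hy0] using h2
  have hx0 := eq_zero_of_hilbertLMatrix_mulVec hi0 (hA.mulVec_eigenvectorBasis i) hz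
  exact hA.eigenvectorBasis.orthonormal.ne_zero i ((WithLp.equiv 2 _).injective hx0)

theorem ncard_spectrum_inter (n : ℕ) (ν a b : ℝ) (ha : 0 ≤ a) :
    Set.ncard {μ : ℝ | μ ∈ spectrum ℝ (hilbertLMatrix n ν) ∧ a < μ ∧ μ < b} =
      Fintype.card {i // a < (hilbertLMatrix_isHermitian n ν).eigenvalues i ∧
        (hilbertLMatrix_isHermitian n ν).eigenvalues i < b} := by
  set hA := hilbertLMatrix_isHermitian n ν
  have h : {μ : ℝ | μ ∈ spectrum ℝ (hilbertLMatrix n ν) ∧ a < μ ∧ μ < b} =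
      hA.eigenvalues '' {i | a < hA.eigenvalues i ∧ hA.eigenvalues i < b} := by
    rw [hA.spectrum_real_eq_range_eigenvalues]
    ext μ
    constructor
    · rintro ⟨⟨i, rfl⟩, h⟩
      exact ⟨i, h, rfl⟩
    · rintro ⟨i, h, rfl⟩
      exact ⟨⟨i, rfl⟩, h⟩
  rw [h, Set.InjOn.ncard_image ((hilbertLMatrix_eigenvalues_injOn n ν).mono
    fun i hi => ha.trans_lt hi.1), ← Nat.card_coe_set_eq, Nat.card_eq_fintype_card]
  rfl

/-! ### Summation by parts and Picone's identity -/

section QuadraticForm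

/-- The pairs with max(i, j) = k form the square of side k+1 minus the square of side k. -/
theorem sum_max_mul_eq (a V : ℕ → ℝ) (n : ℕ) :
    ∑ i ∈ Finset.range n, V i * ∑ j ∈ Finset.range n, a (max i j) * V j =
      ∑ i ∈ Finset.range n, a i * ((∑ j ∈ Finset.range (i + 1), V j) ^ 2 -
        (∑ j ∈ Finset.range i, V j) ^ 2) := by
  induction n with
  | zero => simp
  | succ n ih =>
    have h1 : ∀ i ∈ Finset.range n, a (max i n) = a n := fun i hi => by
      rw [max_eq_right (Finset.mem_range.1 hi).le]
    have h2 : ∑ j ∈ Finset.range n, a (max n j) * V j = a n * ∑ j ∈ Finset.range n, V j := by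
      rw [Finset.mul_sum]
      refine Finset.sum_congr rfl fun i hi => ?_
      rw [max_comm, h1 i hi]
    have h3 : ∑ i ∈ Finset.range n, V i * (a (max i n) * V n) =
        a n * V n * ∑ j ∈ Finset.range n, V j := by
      rw [Finset.mul_sum]
      refine Finset.sum_congr rfl fun i hi => ?_
      rw [h1 i hi]; ring
    rw [Finset.sum_range_succ, Finset.sum_range_succ (fun i => a i * _), ← ih]
    simp only [Finset.sum_range_succ _ n, mul_add, Finset.sum_add_distrib, h2, h3, max_self]
    ring

theorem sum_mul_sub_sq_eq (a P : ℕ → ℝ) (h0 : P 0 = 0) (n : ℕ) :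
    ∑ i ∈ Finset.range n, a i * (P (i + 1) ^ 2 - P i ^ 2) =
      a n * P n ^ 2 + ∑ i ∈ Finset.range n, (a i - a (i + 1)) * P (i + 1) ^ 2 := by
  induction n with
  | zero => simp [h0]
  | succ n ih => rw [Finset.sum_range_succ, Finset.sum_range_succ, ih]; ring

/-- The increments of a sequence, as a vector. -/
def increments (n : ℕ) (P : ℕ → ℝ) : Fin n → ℝ := fun i => P (i + 1) - P i

theorem increments_dotProduct_self (n : ℕ) (P : ℕ → ℝ) :
    increments n P ⬝ᵥ increments n P = ∑ i ∈ Finset.range n, (P (i + 1) - P i) ^ 2 := by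
  rw [Finset.sum_range]
  exact Finset.sum_congr rfl fun i _ => (sq _).symm

theorem increments_dotProduct_mulVec (n : ℕ) (ν : ℝ) (P : ℕ → ℝ) (h0 : P 0 = 0) (hn : P n = 0) :
    increments n P ⬝ᵥ (hilbertLMatrix n ν).mulVec (increments n P) =
      ∑ i ∈ Finset.range n,
        (1 / ((i : ℝ) + ν) - 1 / (((i + 1 : ℕ) : ℝ) + ν)) * P (i + 1) ^ 2 := by
  have h := sum_max_mul_eq (fun i => 1 / ((i : ℝ) + ν)) (fun i => P (i + 1) - P i) n
  simp only [Finset.sum_range_sub, h0, sub_zero] at h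
  rw [sum_mul_sub_sq_eq _ P h0, hn] at h
  rw [Finset.sum_range] at h
  simp only [Finset.sum_range (n := n) (fun j => _ * (P (j + 1) - P j))] at h
  simpa [dotProduct, Matrix.mulVec, hilbertLMatrix, increments] using h

/-- The discrete Picone identity, summed. -/
theorem sum_sq_sub_eq_picone (u φ : ℕ → ℝ) (n : ℕ) (h0 : φ 0 = 0) (hn : φ n = 0) :
    ∑ i ∈ Finset.range n, (u (i + 1) * φ (i + 1) - u i * φ i) ^ 2 =
      ∑ i ∈ Finset.range n, (u i * u (i + 1) * (φ (i + 1) - φ i) ^ 2 +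
        φ (i + 1) ^ 2 * u (i + 1) * (2 * u (i + 1) - u i - u (i + 2))) := by
  -- The correction is the difference of φ_i² u_i (u_{i+1} - u_i); it telescopes to zero because φ
  -- vanishes at both ends.
  have h : ∀ i, (u (i + 1) * φ (i + 1) - u i * φ i) ^ 2 =
      (u i * u (i + 1) * (φ (i + 1) - φ i) ^ 2 +
        φ (i + 1) ^ 2 * u (i + 1) * (2 * u (i + 1) - u i - u (i + 2))) +
      (φ (i + 1) ^ 2 * u (i + 1) * (u (i + 1 + 1) - u (i + 1)) -
        φ i ^ 2 * u i * (u (i + 1) - u i)) := fun i => by ring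
  rw [Finset.sum_congr rfl fun i _ => h i, Finset.sum_add_distrib,
    Finset.sum_range_sub (fun i => φ i ^ 2 * u i * (u (i + 1) - u i)), h0, hn]
  simp

end QuadraticForm

/-! ### Nodal counts -/

/-- A sequence `u` with nodal counting function `f`: `f` grows by at most one at each step, and it
grows exactly when `u` changes sign. -/
structure IsNodalCount (u : ℕ → ℝ) (f : ℕ → ℤ) : Prop where
  ne_zero : ∀ i, u (i + 1) ≠ 0
  zero : u 0 = 0
  mono : ∀ i, f i ≤ f (i + 1)
  le_add_one : ∀ i, f (i + 1) ≤ f i + 1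
  mul_nonneg : ∀ i, f i = f (i + 1) → 0 ≤ u i * u (i + 1)
  mul_nonpos : ∀ i, f i ≠ f (i + 1) → u i * u (i + 1) ≤ 0

namespace IsNodalCount

variable {u : ℕ → ℝ} {f : ℕ → ℤ}

theorem monotone (h : IsNodalCount u f) : Monotone f := monotone_nat_of_le_succ h.mono

theorem card_jumps_le (h : IsNodalCount u f) (m n : ℕ) (hmn : m ≤ n) :
    (((Finset.Ico m n).filter fun i => f i ≠ f (i + 1)).card : ℤ) ≤ f n - f m := by
  induction n, hmn using Nat.le_induction with
  | base => simp
  | succ n hn ih =>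
    rw [← Finset.insert_Ico_right_eq_Ico_add_one hn, Finset.filter_insert]
    have := h.mono n
    split_ifs with hc
    · rw [Finset.card_insert_of_notMem (by simp)]
      push_cast
      have : f n < f (n + 1) := lt_of_le_of_ne this hc
      omega
    · omega

/-- A discrete intermediate value property: every nodal interval strictly between the end values is
visited, so a nonzero coefficient on it is detected. -/
theorem exists_eq (h : IsNodalCount u f) {m n : ℕ} {k : ℤ} (hm : f m < k) (hn : k < f n) :
    ∃ i, m ≤ i ∧ i + 1 < n ∧ f (i + 1) = k := by
  have hex : ∃ i, k ≤ f i := ⟨n, hn.le⟩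
  classical
  have hs := Nat.find_spec hex
  have hmin := fun j => Nat.find_min hex (m := j)
  set i := Nat.find hex
  have hmi : m < i := by
    by_contra hle
    have := h.monotone (not_lt.1 hle)
    omega
  obtain ⟨j, hj⟩ : ∃ j, i = j + 1 := ⟨i - 1, by omega⟩
  have h1 := hmin j (by omega)
  have h2 := h.le_add_one j
  rw [hj] at hs
  refine ⟨j, by omega, ?_, by omega⟩
  by_contra hle
  have := h.monotone (not_lt.1 hle)
  omega

end IsNodalCount

/-! ### Eigenvalue counts against sign changes -/

section Counting

variable {u : ℕ → ℝ} {f : ℕ → ℤ} {q : ℕ → ℝ} {ν μ : ℝ} {m n : ℕ}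

/-- Partial sums of a vector, extended by zero. -/
noncomputable def prefixSums (n : ℕ) : (Fin n → ℝ) →ₗ[ℝ] (ℕ → ℝ) where
  toFun v k := ∑ j ∈ Finset.range k, Function.ExtendByZero.linearMap ℝ Fin.val v j
  map_add' v w := by ext k; simp only [map_add, Pi.add_apply, Finset.sum_add_distrib]
  map_smul' c v := by
    ext k; simp only [map_smul, Pi.smul_apply, smul_eq_mul, Finset.mul_sum, RingHom.id_apply]

theorem increments_prefixSums (v : Fin n → ℝ) : increments n (prefixSums n v) = v := by
  ext i
  simp [increments, prefixSums, Finset.sum_range_succ, Fin.val_injective.extend_apply]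

/-- Put P = uφ and require φ = 0 at 0, …, m and at n, and Δφ = 0 at each jump of f: at most m + 2 +
(f n - f m) conditions. The gradient term in Picone's identity is then nonnegative. -/
theorem card_eigenvalues_gt_le (h : IsNodalCount u f) (hmn : m ≤ n) (hμ : 0 ≤ μ)
    (hrec : ∀ i ≥ m, 2 * u (i + 1) - u i - u (i + 2) = q (i + 1) * u (i + 1))
    (hq : ∀ i ≥ m, 1 / ((i : ℝ) + ν) - 1 / (((i + 1 : ℕ) : ℝ) + ν) ≤ μ * q (i + 1)) :
    (Fintype.card {i // μ < (hilbertLMatrix_isHermitian n ν).eigenvalues i} : ℤ) ≤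
      m + 2 + (f n - f m) := by
  classical
  let S := (Finset.Ico m n).filter fun i => f i ≠ f (i + 1)
  let φ : (Fin n → ℝ) →ₗ[ℝ] (ℕ → ℝ) :=
    { toFun := fun v i => prefixSums n v i / u i
      map_add' := fun v w => by ext i; simp [add_div]
      map_smul' := fun c v => by ext i; simp [mul_div_assoc] }
  let F : (Fin n → ℝ) →ₗ[ℝ] ((Fin (m + 1) ⊕ Unit ⊕ S) → ℝ) := LinearMap.pi fun j =>
    match j with
    | .inl i => LinearMap.proj (i : ℕ) ∘ₗ φ
    | .inr (.inl _) => LinearMap.proj n ∘ₗ φ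
    | .inr (.inr i) => LinearMap.proj ((i : ℕ) + 1) ∘ₗ φ - LinearMap.proj (i : ℕ) ∘ₗ φ
  have hcard := card_eigenvalues_gt_le_card (hilbertLMatrix_isHermitian n ν) μ F (by
    intro v hv
    have hlow : ∀ i ≤ m, φ v i = 0 := fun i hi =>
      congrFun hv (.inl ⟨i, Nat.lt_succ_of_le hi⟩)
    have hhigh : φ v n = 0 := congrFun hv (.inr (.inl ()))
    have hjump : ∀ i ∈ S, φ v (i + 1) - φ v i = 0 := fun i hi =>
      congrFun hv (.inr (.inr ⟨i, hi⟩))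
    -- At i = 0 both sides vanish, whatever value the division by u 0 = 0 takes.
    have hP : ∀ i, prefixSums n v i = u i * φ v i := by
      intro i
      rcases i with _ | i
      · simp [prefixSums, h.zero]
      · exact (mul_div_cancel₀ _ (h.ne_zero i)).symm
    have hv' := increments_prefixSums v
    rw [← hv', increments_dotProduct_mulVec n ν _ (by simp [prefixSums]) (by rw [hP, hhigh, mul_zero]),
      increments_dotProduct_self]
    simp only [hP]
    rw [sum_sq_sub_eq_picone u (φ v) n (hlow 0 (Nat.zero_le _)) hhigh, Finset.mul_sum]
    refine Finset.sum_le_sum fun i hi => ?_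
    rcases Nat.lt_or_ge i m with him | him
    · simp [hlow i him.le, hlow (i + 1) him]
    · rw [hrec i him]
      have h1 : 0 ≤ u i * u (i + 1) * (φ v (i + 1) - φ v i) ^ 2 := by
        by_cases hf : f i = f (i + 1)
        · exact mul_nonneg (h.mul_nonneg i hf) (sq_nonneg _)
        · rw [hjump i (by simp [S, hf, him, Finset.mem_range.1 hi])]; simp
      have h2 := mul_le_mul_of_nonneg_right (hq i him) (sq_nonneg (u (i + 1) * φ v (i + 1)))
      have h3 := mul_nonneg hμ h1
      linarith [h2, h3])
  have hS := h.card_jumps_le m n hmn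
  simp only [Fintype.card_sum, Fintype.card_fin, Fintype.card_unit, Fintype.card_coe] at hcard
  zify at hcard
  linarith

/-- Take φ constant on each nodal interval. Then Δφ ≠ 0 only where u changes sign, so the gradient
term in Picone's identity is nonpositive. -/
theorem le_card_eigenvalues_gt (h : IsNodalCount u f) (hμ : 0 ≤ μ)
    (hrec : ∀ i ≥ m, 2 * u (i + 1) - u i - u (i + 2) = q (i + 1) * u (i + 1))
    (hq : ∀ i ≥ m, μ * q (i + 1) < 1 / ((i : ℝ) + ν) - 1 / (((i + 1 : ℕ) : ℝ) + ν)) :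
    f n - f m - 1 ≤
      (Fintype.card {i // μ < (hilbertLMatrix_isHermitian n ν).eigenvalues i} : ℤ) := by
  -- Omitting the end values makes φ vanish up to m and at n.
  let K := Finset.Ioo (f m) (f n)
  let E : (K → ℝ) →ₗ[ℝ] (ℤ → ℝ) := Function.ExtendByZero.linearMap ℝ Subtype.val
  have hE0 : ∀ c, ∀ k ∉ K, E c k = 0 := fun c k hk =>
    Function.extend_apply' _ _ _ (by rintro ⟨a, rfl⟩; exact hk a.2)
  have hE1 : ∀ c (k : K), E c k = c k := fun c k => Subtype.val_injective.extend_apply _ _ _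
  let T : (K → ℝ) →ₗ[ℝ] (Fin n → ℝ) :=
    { toFun := fun c => increments n fun i => u i * E c (f i)
      map_add' := fun c d => by ext i; simp [increments]; ring
      map_smul' := fun c d => by ext i; simp [increments]; ring }
  have hcard := card_le_card_eigenvalues_gt (hilbertLMatrix_isHermitian n ν) μ T (by
    intro c hc
    set φ : ℕ → ℝ := fun i => E c (f i) with hφ
    have hlow : ∀ i ≤ m, φ i = 0 := fun i hi => hE0 c _ (by
      have := h.monotone hi
      simp [K]; omega)
    have hhigh : φ n = 0 := hE0 c _ (by simp [K])
    change μ * (increments n (fun i => u i * φ i) ⬝ᵥ increments n (fun i => u i * φ i)) <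
      increments n (fun i => u i * φ i) ⬝ᵥ
        (hilbertLMatrix n ν).mulVec (increments n (fun i => u i * φ i))
    rw [increments_dotProduct_mulVec n ν _ (by simp [h.zero]) (by simp [hhigh]),
      increments_dotProduct_self,
      sum_sq_sub_eq_picone u φ n (hlow 0 (Nat.zero_le _)) hhigh, Finset.mul_sum]
    have hjump : ∀ i, u i * u (i + 1) * (φ (i + 1) - φ i) ^ 2 ≤ 0 := by
      intro i
      by_cases hf : f i = f (i + 1)
      · simp [hφ, hf]
      · exact mul_nonpos_of_nonpos_of_nonneg (h.mul_nonpos i hf) (sq_nonneg _)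
    refine Finset.sum_lt_sum (fun i _ => ?_) ?_
    · rcases Nat.lt_or_ge i m with him | him
      · simp [hlow i him.le, hlow (i + 1) him]
      · rw [hrec i him]
        have h2 := mul_le_mul_of_nonneg_right (hq i him).le (sq_nonneg (u (i + 1) * φ (i + 1)))
        have h3 := mul_nonpos_of_nonneg_of_nonpos hμ (hjump i)
        linarith [h2, h3]
    · obtain ⟨k, hk⟩ := Function.ne_iff.1 hc
      obtain ⟨i, hmi, hin, hi⟩ := h.exists_eq (Finset.mem_Ioo.1 k.2).1 (Finset.mem_Ioo.1 k.2).2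
      refine ⟨i, Finset.mem_range.2 (by omega), ?_⟩
      rw [hrec i hmi]
      have hne : φ (i + 1) ≠ 0 := by
        simp only [hφ, hi, hE1]
        exact hk
      have h2 := mul_lt_mul_of_pos_right (hq i hmi)
        (pow_pos (abs_pos.2 (mul_ne_zero (h.ne_zero i) hne)) 2)
      rw [sq_abs] at h2
      have h3 := mul_nonpos_of_nonneg_of_nonpos hμ (hjump i)
      linarith [h2, h3])
  rw [Fintype.card_coe, Int.card_Ioo] at hcard
  omega

end Counting

/-! ### The oscillating comparison sequence -/

section Oscillation

theorem sin_mul_sin_nonneg_of_floor_eq {x y : ℝ} (h : ⌊x / Real.pi⌋ = ⌊y / Real.pi⌋) :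
    0 ≤ Real.sin x * Real.sin y := by
  have key : ∀ z : ℝ, 0 ≤ Real.sin (z - ⌊z / Real.pi⌋ * Real.pi) := by
    intro z
    have h1 := Int.floor_le (z / Real.pi)
    have h2 := (Int.lt_floor_add_one (z / Real.pi)).le
    rw [le_div_iff₀ Real.pi_pos] at h1
    rw [div_le_iff₀ Real.pi_pos] at h2
    exact Real.sin_nonneg_of_nonneg_of_le_pi (by linarith) (by linarith)
  have hx := key x
  have hy := key y
  rw [Real.sin_sub_int_mul_pi] at hx hy
  rw [h] at hx
  have := mul_nonneg hx hy
  rcases Int.even_or_odd ⌊y / Real.pi⌋ with he | he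
  · simpa [he.neg_one_zpow] using this
  · simpa [he.neg_one_zpow] using this

theorem sin_mul_sin_nonpos_of_floor_eq_add_one {x y : ℝ}
    (h : ⌊y / Real.pi⌋ = ⌊x / Real.pi⌋ + 1) : Real.sin x * Real.sin y ≤ 0 := by
  have h1 : ⌊x / Real.pi⌋ = ⌊(y - Real.pi) / Real.pi⌋ := by
    rw [sub_div, div_self Real.pi_ne_zero, Int.floor_sub_one, h]; ring
  have := sin_mul_sin_nonneg_of_floor_eq h1
  rw [Real.sin_sub_pi] at this
  linarith

/-- The phase increments of the oscillating sequence. -/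
noncomputable def phaseStep (s : ℝ) (i : ℕ) : ℝ := Real.arcsin (s / √((i : ℝ) * (i + 1)))

theorem phaseStep_nonneg {s : ℝ} (hs : 0 < s) (i : ℕ) : 0 ≤ phaseStep s i :=
  Real.arcsin_nonneg.2 (by positivity)

theorem phaseStep_le (s : ℝ) (i : ℕ) : phaseStep s i ≤ Real.pi := by
  have := Real.arcsin_le_pi_div_two (s / √((i : ℝ) * (i + 1)))
  have := Real.pi_pos
  unfold phaseStep
  linarith

/-- The phase of the oscillating sequence. -/
noncomputable def phase (s c : ℝ) (i : ℕ) : ℝ := c + ∑ j ∈ Finset.range i, phaseStep s j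

theorem phase_succ (s c : ℝ) (i : ℕ) : phase s c (i + 1) = phase s c i + phaseStep s i := by
  simp [phase, Finset.sum_range_succ, add_assoc]

/-- Only countably many offsets c are bad. Avoiding them keeps the comparison sequence nonzero at
positive indices. -/
theorem exists_phase_ne (s : ℝ) : ∃ c : ℝ, ∀ (i : ℕ) (k : ℤ), (k : ℝ) * Real.pi ≠ phase s c i := by
  obtain ⟨c, hc⟩ := ((Set.countable_range fun p : ℕ × ℤ =>
    (p.2 : ℝ) * Real.pi - phase s 0 p.1).dense_compl ℝ).nonempty
  refine ⟨c, fun i k hk => hc ⟨(i, k), ?_⟩⟩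
  simp only [phase] at hk ⊢
  linarith

/-- The oscillating sequence `√i sin θ_i`. -/
noncomputable def oscSeq (s c : ℝ) (i : ℕ) : ℝ := √(i : ℝ) * Real.sin (phase s c i)

theorem isNodalCount_oscSeq {s c : ℝ} (hs : 0 < s)
    (hc : ∀ (i : ℕ) (k : ℤ), (k : ℝ) * Real.pi ≠ phase s c i) :
    IsNodalCount (oscSeq s c) fun i => ⌊phase s c i / Real.pi⌋ := by
  have hmono : ∀ i, ⌊phase s c i / Real.pi⌋ ≤ ⌊phase s c (i + 1) / Real.pi⌋ := by
    intro i
    refine Int.floor_le_floor (div_le_div_of_nonneg_right ?_ Real.pi_pos.le)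
    rw [phase_succ]
    linarith [phaseStep_nonneg hs i]
  have hle : ∀ i, ⌊phase s c (i + 1) / Real.pi⌋ ≤ ⌊phase s c i / Real.pi⌋ + 1 := by
    intro i
    rw [← Int.floor_add_one]
    refine Int.floor_le_floor ?_
    rw [phase_succ, add_div]
    have := (div_le_one Real.pi_pos).2 (phaseStep_le s i)
    linarith
  have hmul : ∀ i, oscSeq s c i * oscSeq s c (i + 1) =
      (√(i : ℝ) * √((i + 1 : ℕ) : ℝ)) * (Real.sin (phase s c i) * Real.sin (phase s c (i + 1))) :=
    fun i => by unfold oscSeq; ring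
  refine ⟨fun i => ?_, by simp [oscSeq], hmono, hle, fun i hi => ?_, fun i hi => ?_⟩
  · refine mul_ne_zero (by positivity) fun h => ?_
    obtain ⟨k, hk⟩ := Real.sin_eq_zero_iff.1 h
    exact hc _ _ hk
  · rw [hmul]
    exact mul_nonneg (by positivity) (sin_mul_sin_nonneg_of_floor_eq hi)
  · rw [hmul]
    refine mul_nonpos_of_nonneg_of_nonpos (by positivity)
      (sin_mul_sin_nonpos_of_floor_eq_add_one ?_)
    have h1 := hmono i
    have h2 := hle i
    have h3 : ⌊phase s c i / Real.pi⌋ ≠ ⌊phase s c (i + 1) / Real.pi⌋ := hi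
    omega

/-- The potential for which the oscillating sequence solves the discrete Schrödinger equation,
as a function of `h = 1 / i`. -/
noncomputable def oscPotential (s h : ℝ) : ℝ :=
  2 - √(1 + h - s ^ 2 * h ^ 2) - √(1 - h - s ^ 2 * h ^ 2)

/-- With phase steps δ_i, √i sin δ_i = s/√(i+1) = √(i+2) sin δ_{i+1}, so the cos θ_{i+1} terms of
u_i + u_{i+2} cancel. The bound s ≤ i keeps the arcsine arguments at most 1. -/
theorem oscSeq_recurrence {s c : ℝ} (hs : 0 < s) (i : ℕ) (hi : 1 ≤ i) (hsi : s ≤ i) :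
    2 * oscSeq s c (i + 1) - oscSeq s c i - oscSeq s c (i + 2) =
      oscPotential s (((i + 1 : ℕ) : ℝ)⁻¹) * oscSeq s c (i + 1) := by
  have hi0 : (0 : ℝ) < i := by exact_mod_cast hi
  set t : ℝ := (i : ℝ) with ht
  have hs2 : s ^ 2 ≤ t * (t + 1) := by nlinarith
  have hle : ∀ j : ℕ, i ≤ j → s / √((j : ℝ) * (j + 1)) ≤ 1 := by
    intro j hj
    have hjt : t ≤ j := Nat.cast_le.2 hj
    have hj0 : (0 : ℝ) < j := hi0.trans_le hjt
    rw [div_le_one (by positivity)]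
    refine Real.le_sqrt_of_sq_le ?_
    nlinarith
  have hsin : ∀ j : ℕ, i ≤ j → Real.sin (phaseStep s j) = s / √((j : ℝ) * (j + 1)) := by
    intro j hj
    refine Real.sin_arcsin ?_ (hle j hj)
    have : 0 ≤ s / √((j : ℝ) * (j + 1)) := by positivity
    linarith
  have hcos : ∀ j : ℕ, Real.cos (phaseStep s j) = √(1 - (s / √((j : ℝ) * (j + 1))) ^ 2) :=
    fun j => Real.cos_arcsin _
  have e0 : phase s c i = phase s c (i + 1) - phaseStep s i := by rw [phase_succ]; ring
  have e2 : phase s c (i + 2) = phase s c (i + 1) + phaseStep s (i + 1) := phase_succ s c (i + 1)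
  have c1 : ((i + 1 : ℕ) : ℝ) = t + 1 := by push_cast; rfl
  have c2 : ((i + 2 : ℕ) : ℝ) = t + 2 := by push_cast; rfl
  have s0 : √t * Real.sin (phaseStep s i) = s / √(t + 1) := by
    rw [hsin i le_rfl, ← ht, Real.sqrt_mul hi0.le]
    field_simp
  have s1 : √(t + 2) * Real.sin (phaseStep s (i + 1)) = s / √(t + 1) := by
    rw [hsin (i + 1) (Nat.le_succ i), c1, Real.sqrt_mul (by positivity),
      show t + 1 + 1 = t + 2 by ring]
    field_simp
  have k0 : √t * Real.cos (phaseStep s i) =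
      √(t + 1) * √(1 - (t + 1)⁻¹ - s ^ 2 * (t + 1)⁻¹ ^ 2) := by
    rw [hcos, ← Real.sqrt_mul hi0.le, ← Real.sqrt_mul (by positivity), div_pow,
      Real.sq_sqrt (by positivity)]
    congr 1
    field_simp
    ring
  have k1 : √(t + 2) * Real.cos (phaseStep s (i + 1)) =
      √(t + 1) * √(1 + (t + 1)⁻¹ - s ^ 2 * (t + 1)⁻¹ ^ 2) := by
    rw [hcos, ← Real.sqrt_mul (by positivity), ← Real.sqrt_mul (by positivity), div_pow,
      Real.sq_sqrt (by positivity), c1]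
    congr 1
    field_simp
    ring
  simp only [oscSeq, oscPotential, c1, c2, e0, e2, Real.sin_sub, Real.sin_add, ← ht]
  linear_combination (-Real.sin (phase s c (i + 1))) * (k0 + k1) +
    Real.cos (phase s c (i + 1)) * (s0 - s1)

theorem tendsto_oscPotential (s : ℝ) :
    Tendsto (fun h => oscPotential s h / h ^ 2) (𝓝[≠] 0) (𝓝 (s ^ 2 + 1 / 4)) := by
  -- Here z is the product of the two radicands. Rationalising 2 - A - B and then 1 - √z extracts
  -- the factor h², and g is the remaining continuous quotient.
  let z : ℝ → ℝ := fun h => 1 - ((2 * s ^ 2 + 1) * h ^ 2 - s ^ 4 * h ^ 4)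
  let g : ℝ → ℝ := fun h =>
    (2 * s ^ 2 + 2 * (2 * s ^ 2 + 1 - s ^ 4 * h ^ 2) / (1 + √(z h))) /
      (2 + √(1 + h - s ^ 2 * h ^ 2) + √(1 - h - s ^ 2 * h ^ 2))
  have hg : ContinuousAt g 0 := by
    refine ContinuousAt.div ?_ (by fun_prop) (by positivity)
    refine ContinuousAt.add (by fun_prop) (ContinuousAt.div (by fun_prop) (by fun_prop) ?_)
    positivity
  have hg0 : g 0 = s ^ 2 + 1 / 4 := by
    simp [g, z]; ring
  rw [← hg0]
  refine Tendsto.congr' ?_ (hg.tendsto.mono_left nhdsWithin_le_nhds)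
  have ev1 : ∀ᶠ h : ℝ in 𝓝[≠] 0, 0 < 1 + h - s ^ 2 * h ^ 2 := by
    refine nhdsWithin_le_nhds (ContinuousAt.eventually_lt continuousAt_const (by fun_prop) ?_)
    simp
  have ev2 : ∀ᶠ h : ℝ in 𝓝[≠] 0, 0 < 1 - h - s ^ 2 * h ^ 2 := by
    refine nhdsWithin_le_nhds (ContinuousAt.eventually_lt continuousAt_const (by fun_prop) ?_)
    simp
  filter_upwards [ev1, ev2, self_mem_nhdsWithin] with h h1 h2 h0
  have h0' : h ≠ 0 := h0
  have hzeq : z h = (1 + h - s ^ 2 * h ^ 2) * (1 - h - s ^ 2 * h ^ 2) := by simp only [z]; ring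
  have hAB : √(z h) = √(1 + h - s ^ 2 * h ^ 2) * √(1 - h - s ^ 2 * h ^ 2) := by
    rw [hzeq, Real.sqrt_mul h1.le]
  have hz2 : √(z h) ^ 2 = z h := Real.sq_sqrt (by rw [hzeq]; positivity)
  have hA := Real.sq_sqrt h1.le
  have hB := Real.sq_sqrt h2.le
  simp only [g, oscPotential]
  set A := √(1 + h - s ^ 2 * h ^ 2)
  set B := √(1 - h - s ^ 2 * h ^ 2)
  set C := √(z h)
  have hA0 : 0 ≤ A := Real.sqrt_nonneg _
  have hB0 : 0 ≤ B := Real.sqrt_nonneg _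
  have hC0 : 0 ≤ C := Real.sqrt_nonneg _
  have hC : 2 * (2 * s ^ 2 + 1 - s ^ 4 * h ^ 2) / (1 + C) * h ^ 2 = 2 * (1 - C) := by
    rw [div_mul_eq_mul_div, div_eq_iff (by positivity)]
    simp only [z] at hz2
    linear_combination 2 * hz2
  rw [div_eq_div_iff (by positivity) (by positivity), add_mul, hC]
  linear_combination hA + hB - 2 * hAB

theorem tendsto_phaseStep {s : ℝ} (hs : 0 < s) :
    Tendsto (fun i : ℕ => phaseStep s i * ((i : ℝ) + 1)) atTop (𝓝 s) := by
  let y : ℕ → ℝ := fun i => s / √((i : ℝ) * (i + 1))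
  have hy0 : ∀ᶠ i in atTop, y i ≠ 0 := by
    filter_upwards [eventually_gt_atTop 0] with i hi
    have : (0 : ℝ) < i := by exact_mod_cast hi
    positivity
  have hy : Tendsto y atTop (𝓝 0) := by
    refine Tendsto.const_div_atTop (Real.tendsto_sqrt_atTop.comp ?_) s
    refine Tendsto.atTop_mul_atTop₀ tendsto_natCast_atTop_atTop ?_
    exact tendsto_natCast_atTop_atTop.atTop_add tendsto_const_nhds
  have hy1 : Tendsto (fun i => y i * ((i : ℝ) + 1)) atTop (𝓝 s) := by
    have h1 : Tendsto (fun i : ℕ => s * √(1 + 1 / (i : ℝ))) atTop (𝓝 (s * √(1 + 0))) :=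
      ((tendsto_const_nhds.add tendsto_one_div_atTop_nhds_zero_nat).sqrt).const_mul s
    rw [add_zero, Real.sqrt_one, mul_one] at h1
    refine h1.congr' ?_
    filter_upwards [eventually_gt_atTop 0] with i hi
    have hi0 : (0 : ℝ) < i := by exact_mod_cast hi
    have e : 1 + 1 / (i : ℝ) = (i + 1) / i := by field_simp
    have e2 : ((i : ℝ) + 1) = √((i : ℝ) + 1) ^ 2 := (Real.sq_sqrt (by positivity)).symm
    simp only [y]
    rw [e, Real.sqrt_div (by positivity), Real.sqrt_mul hi0.le]
    nth_rewrite 3 [e2]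
    field_simp
  have hd : Tendsto (fun t : ℝ => t⁻¹ * Real.arcsin t) (𝓝[≠] 0) (𝓝 1) := by
    have h := (Real.hasDerivAt_arcsin (x := 0) (by norm_num) (by norm_num)).tendsto_slope_zero
    simpa using h
  have hlim := (hd.comp (tendsto_nhdsWithin_iff.2 ⟨hy, hy0⟩)).mul hy1
  rw [one_mul] at hlim
  refine hlim.congr' ?_
  filter_upwards [hy0] with i hi
  simp only [Function.comp_apply, phaseStep]
  change (y i)⁻¹ * Real.arcsin (y i) * (y i * (i + 1)) = Real.arcsin (y i) * (i + 1)
  field_simp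

theorem tendsto_log_natCast_atTop : Tendsto (fun n : ℕ => Real.log n) atTop atTop :=
  Real.tendsto_log_atTop.comp tendsto_natCast_atTop_atTop

theorem tendsto_div_log_zero_of_bounded {g : ℕ → ℝ} {C : ℝ} (hg : ∀ n, |g n| ≤ C) :
    Tendsto (fun n : ℕ => g n / Real.log n) atTop (𝓝 0) := by
  have h := (tendsto_log_natCast_atTop.const_div_atTop C)
  refine squeeze_zero_norm' ?_ h
  filter_upwards [tendsto_log_natCast_atTop.eventually_gt_atTop 0] with n hn
  rw [Real.norm_eq_abs, abs_div, abs_of_pos hn]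
  exact div_le_div_of_nonneg_right (hg n) hn.le

theorem tendsto_harmonic_div_log :
    Tendsto (fun n : ℕ => (harmonic n : ℝ) / Real.log n) atTop (𝓝 1) := by
  have h1 := Real.tendsto_harmonic_sub_log.div_atTop tendsto_log_natCast_atTop
  have h2 := h1.add_const 1
  rw [zero_add] at h2
  refine h2.congr' ?_
  filter_upwards [tendsto_log_natCast_atTop.eventually_gt_atTop 0] with n hn
  field_simp
  ring

/-- The steps are s/(i+1) + o(1/(i+1)); since the harmonic series diverges, the errors sum to o(log
n). -/
theorem tendsto_phase_div_log {s : ℝ} (hs : 0 < s) (c : ℝ) :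
    Tendsto (fun n : ℕ => phase s c n / Real.log n) atTop (𝓝 s) := by
  let g : ℕ → ℝ := fun i => ((i : ℝ) + 1)⁻¹
  have hgsum : ∀ n, ∑ i ∈ Finset.range n, g i = (harmonic n : ℝ) := by
    intro n; simp [harmonic, g]
  have hgtop : Tendsto (fun n => ∑ i ∈ Finset.range n, g i) atTop atTop := by
    simp only [hgsum]
    have h := tendsto_harmonic_div_log.pos_mul_atTop one_pos tendsto_log_natCast_atTop
    refine h.congr' ?_
    filter_upwards [tendsto_log_natCast_atTop.eventually_gt_atTop 0] with n hn
    field_simp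
  have hlo : (fun i => phaseStep s i - s * g i) =o[atTop] g := by
    rw [Asymptotics.isLittleO_iff_tendsto fun i hi => absurd hi (by positivity)]
    have h := (tendsto_phaseStep hs).sub_const s
    rw [sub_self] at h
    refine h.congr fun i => ?_
    simp only [g]
    field_simp
  have hsum := (hlo.sum_range (fun i => by positivity) hgtop).tendsto_div_nhds_zero
  simp only [Finset.sum_sub_distrib, ← Finset.mul_sum, hgsum] at hsum hgtop
  have hc : Tendsto (fun n : ℕ => c / Real.log n) atTop (𝓝 0) :=
    tendsto_log_natCast_atTop.const_div_atTop c
  have hfin := hc.add ((hsum.add_const s).mul tendsto_harmonic_div_log)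
  simp only [zero_add, mul_one] at hfin
  refine hfin.congr' ?_
  filter_upwards [tendsto_log_natCast_atTop.eventually_gt_atTop 0,
    hgtop.eventually_gt_atTop 0] with n hn hn'
  simp only [phase]
  field_simp
  ring

theorem tendsto_floor_phase_div_log {s : ℝ} (hs : 0 < s) (c : ℝ) :
    Tendsto (fun n : ℕ => (⌊phase s c n / Real.pi⌋ : ℝ) / Real.log n) atTop
      (𝓝 (s / Real.pi)) := by
  have h1 := (tendsto_phase_div_log hs c).div_const Real.pi
  have h2 : Tendsto (fun n : ℕ => Int.fract (phase s c n / Real.pi) / Real.log n) atTop (𝓝 0) :=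
    tendsto_div_log_zero_of_bounded (C := 1) fun n => by
      rw [abs_of_nonneg (Int.fract_nonneg _)]
      exact (Int.fract_lt_one _).le
  have h3 := h1.sub h2
  rw [sub_zero] at h3
  refine h3.congr fun n => ?_
  rw [Int.fract]
  ring

end Oscillation

/-! ### Logarithmic density of the eigenvalues -/

/-- The number of eigenvalues of the `L`-matrix exceeding `μ`, with multiplicity. -/
noncomputable def eigenvalueCount (ν μ : ℝ) (n : ℕ) : ℕ :=
  Fintype.card {i // μ < (hilbertLMatrix_isHermitian n ν).eigenvalues i}

theorem tendsto_sq_mul_sub_one_div (ν : ℝ) :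
    Tendsto (fun i : ℕ => ((i + 1 : ℕ) : ℝ) ^ 2 *
      (1 / ((i : ℝ) + ν) - 1 / (((i + 1 : ℕ) : ℝ) + ν))) atTop (𝓝 1) := by
  have hc : ∀ a : ℝ, Tendsto (fun i : ℕ => ((i : ℝ) + a)⁻¹) atTop (𝓝 0) := fun a =>
    (tendsto_natCast_atTop_atTop.atTop_add tendsto_const_nhds).inv_tendsto_atTop
  -- The factors are (i+1)/(i+ν) and (i+1)/(i+1+ν).
  have h := (((hc ν).const_mul (1 - ν)).const_add 1).mul (((hc (ν + 1)).const_mul (-ν)).const_add 1)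
  simp only [mul_zero, add_zero, mul_one] at h
  refine h.congr' ?_
  filter_upwards [(tendsto_natCast_atTop_atTop (R := ℝ)).eventually_gt_atTop |ν|] with i hi
  have h1 : 0 < (i : ℝ) + ν := by linarith [neg_abs_le ν]
  have h2 : 0 < (i : ℝ) + (ν + 1) := by linarith
  have h3 : 0 < (i : ℝ) + 1 + ν := by linarith
  push_cast
  field_simp
  ring

theorem tendsto_sq_mul_oscPotential (s : ℝ) :
    Tendsto (fun i : ℕ => ((i + 1 : ℕ) : ℝ) ^ 2 * oscPotential s (((i + 1 : ℕ) : ℝ)⁻¹)) atTop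
      (𝓝 (s ^ 2 + 1 / 4)) := by
  have h1 : Tendsto (fun i : ℕ => ((i + 1 : ℕ) : ℝ)⁻¹) atTop (𝓝[≠] 0) := by
    refine tendsto_nhdsWithin_iff.2 ⟨?_, Eventually.of_forall fun i => ?_⟩
    · exact (tendsto_natCast_atTop_atTop.comp (tendsto_add_atTop_nat 1)).inv_tendsto_atTop
    · exact inv_ne_zero (Nat.cast_ne_zero.2 (Nat.succ_ne_zero i))
  refine ((tendsto_oscPotential s).comp h1).congr fun i => ?_
  simp only [Function.comp_apply]
  field_simp

/-- Comparison sequences of frequency `s`. -/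
theorem exists_oscillating {s : ℝ} (hs : 0 < s) : ∃ (u : ℕ → ℝ) (f : ℕ → ℤ), IsNodalCount u f ∧
    (∀ᶠ i : ℕ in atTop, 2 * u (i + 1) - u i - u (i + 2) =
      oscPotential s (((i + 1 : ℕ) : ℝ)⁻¹) * u (i + 1)) ∧
    Tendsto (fun n : ℕ => (f n : ℝ) / Real.log n) atTop (𝓝 (s / Real.pi)) := by
  obtain ⟨c, hc⟩ := exists_phase_ne s
  refine ⟨_, _, isNodalCount_oscSeq hs hc, ?_, tendsto_floor_phase_div_log hs c⟩
  filter_upwards [eventually_ge_atTop 1,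
    (tendsto_natCast_atTop_atTop (R := ℝ)).eventually_ge_atTop s] with i h1 h2
  exact oscSeq_recurrence hs i h1 h2

theorem tendsto_add_const_div_log {f : ℕ → ℤ} {l : ℝ} (C : ℝ)
    (hf : Tendsto (fun n : ℕ => (f n : ℝ) / Real.log n) atTop (𝓝 l)) :
    Tendsto (fun n : ℕ => ((f n : ℝ) + C) / Real.log n) atTop (𝓝 l) := by
  have h := hf.add (tendsto_log_natCast_atTop.const_div_atTop C)
  rw [add_zero] at h
  exact h.congr fun n => (add_div _ _ _).symm

/-- The strict inequality between the limits of the i²-scaled weights gives the pointwise comparison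
from some m on; the terms depending on m are O(1), negligible against log n. -/
theorem eventually_eigenvalueCount_lt (ν : ℝ) {μ s b : ℝ} (hμ : 0 < μ) (hs : 0 < s)
    (hμs : 1 < μ * (s ^ 2 + 1 / 4)) (hb : s / Real.pi < b) :
    ∀ᶠ n : ℕ in atTop, (eigenvalueCount ν μ n : ℝ) / Real.log n < b := by
  obtain ⟨u, f, hu, hrec, hf⟩ := exists_oscillating hs
  have hq := (tendsto_sq_mul_sub_one_div ν).eventually_lt
    ((tendsto_sq_mul_oscPotential s).const_mul μ) hμs
  obtain ⟨m, hm⟩ := eventually_atTop.1 (hrec.and hq)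
  filter_upwards [(tendsto_add_const_div_log ((m : ℝ) + 2 - f m) hf).eventually_lt_const hb,
    eventually_ge_atTop m, tendsto_log_natCast_atTop.eventually_gt_atTop 0] with n hn hmn hlog
  refine lt_of_le_of_lt (div_le_div_of_nonneg_right ?_ hlog.le) hn
  have h := card_eigenvalues_gt_le (ν := ν) (q := fun i => oscPotential s ((i : ℝ)⁻¹)) hu hmn hμ.le
    (fun i hi => (hm i hi).1) (fun i hi => by
      have h1 := (hm i hi).2.le
      rw [mul_left_comm] at h1
      exact le_of_mul_le_mul_left h1 (by positivity))
  have h' : (eigenvalueCount ν μ n : ℝ) ≤ m + 2 + (f n - f m) := by exact_mod_cast h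
  linarith

theorem eventually_lt_eigenvalueCount (ν : ℝ) {μ s b : ℝ} (hμ : 0 < μ) (hs : 0 < s)
    (hμs : μ * (s ^ 2 + 1 / 4) < 1) (hb : b < s / Real.pi) :
    ∀ᶠ n : ℕ in atTop, b < (eigenvalueCount ν μ n : ℝ) / Real.log n := by
  obtain ⟨u, f, hu, hrec, hf⟩ := exists_oscillating hs
  have hq := ((tendsto_sq_mul_oscPotential s).const_mul μ).eventually_lt
    (tendsto_sq_mul_sub_one_div ν) hμs
  obtain ⟨m, hm⟩ := eventually_atTop.1 (hrec.and hq)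
  filter_upwards [(tendsto_add_const_div_log (- f m - 1 : ℝ) hf).eventually_const_lt hb,
    tendsto_log_natCast_atTop.eventually_gt_atTop 0] with n hn hlog
  refine hn.trans_le (div_le_div_of_nonneg_right ?_ hlog.le)
  have h := le_card_eigenvalues_gt (n := n) (ν := ν) (q := fun i => oscPotential s ((i : ℝ)⁻¹))
    hu hμ.le (fun i hi => (hm i hi).1) (fun i hi => by
      have h1 := (hm i hi).2
      rw [mul_left_comm] at h1
      exact lt_of_mul_lt_mul_left h1 (by positivity))
  have h' : (f n : ℝ) - f m - 1 ≤ eigenvalueCount ν μ n := by exact_mod_cast h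
  linarith

theorem tendsto_eigenvalueCount_div_log (ν : ℝ) {s : ℝ} (hs : 0 < s) :
    Tendsto (fun n : ℕ => (eigenvalueCount ν (1 / (s ^ 2 + 1 / 4)) n : ℝ) / Real.log n) atTop
      (𝓝 (s / Real.pi)) := by
  have hpos : 0 < s ^ 2 + 1 / 4 := by positivity
  refine tendsto_order.2 ⟨fun b hb => ?_, fun b hb => ?_⟩
  · rw [lt_div_iff₀ Real.pi_pos] at hb
    obtain ⟨t, ht1, ht2⟩ := exists_between (max_lt hb hs)
    have ht0 : 0 < t := (le_max_right _ _).trans_lt ht1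
    refine eventually_lt_eigenvalueCount ν (by positivity) ht0 ?_
      ((lt_div_iff₀ Real.pi_pos).2 ((le_max_left _ _).trans_lt ht1))
    rw [one_div_mul_eq_div, div_lt_one hpos]
    nlinarith
  · rw [gt_iff_lt, div_lt_iff₀ Real.pi_pos] at hb
    obtain ⟨t, ht1, ht2⟩ := exists_between hb
    refine eventually_eigenvalueCount_lt ν (by positivity) (hs.trans ht1) ?_
      ((div_lt_iff₀ Real.pi_pos).2 ht2)
    rw [one_div_mul_eq_div, one_lt_div hpos]
    nlinarith

/-- The number of eigenvalues of the `L`-matrix that are at least `4`, with multiplicity. -/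
noncomputable def largeEigenvalueCount (ν : ℝ) (n : ℕ) : ℕ :=
  Fintype.card {i // 4 ≤ (hilbertLMatrix_isHermitian n ν).eigenvalues i}

theorem tendsto_largeEigenvalueCount_div_log (ν : ℝ) :
    Tendsto (fun n : ℕ => (largeEigenvalueCount ν n : ℝ) / Real.log n) atTop (𝓝 0) := by
  refine tendsto_order.2 ⟨fun b hb => ?_, fun b hb => ?_⟩
  · filter_upwards [tendsto_log_natCast_atTop.eventually_gt_atTop 0] with n hn
    exact hb.trans_le (by positivity)
  -- Eigenvalues ≥ 4 exceed 1/(s²+1/4) for every s > 0; choose s with s/π < b.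
  · obtain ⟨s, hs0, hs⟩ := exists_between (mul_pos hb Real.pi_pos)
    filter_upwards [(tendsto_eigenvalueCount_div_log ν hs0).eventually_lt_const
      ((div_lt_iff₀ Real.pi_pos).2 hs),
      tendsto_log_natCast_atTop.eventually_gt_atTop 0] with n hn hlog
    refine lt_of_le_of_lt (div_le_div_of_nonneg_right ?_ hlog.le) hn
    have h4 : 1 / (s ^ 2 + 1 / 4) < 4 := by
      rw [div_lt_iff₀ (by positivity)]
      nlinarith [pow_pos hs0 2]
    exact_mod_cast Fintype.card_subtype_mono _ _ fun i hi => h4.trans_le hi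

theorem card_between_add_largeEigenvalueCount (ν : ℝ) {a : ℝ} (ha : a < 4) (n : ℕ) :
    Fintype.card {i // a < (hilbertLMatrix_isHermitian n ν).eigenvalues i ∧
      (hilbertLMatrix_isHermitian n ν).eigenvalues i < 4} + largeEigenvalueCount ν n =
        eigenvalueCount ν a n := by
  rw [largeEigenvalueCount, eigenvalueCount, ← Fintype.card_subtype_or_disjoint]
  · refine Fintype.card_congr (Equiv.subtypeEquivRight fun i => ?_)
    constructor
    · rintro (h | h)
      · exact h.1
      · exact ha.trans_le h
    · intro h
      rcases lt_or_ge ((hilbertLMatrix_isHermitian n ν).eigenvalues i) 4 with h4 | h4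
      · exact .inl ⟨h, h4⟩
      · exact .inr h4
  · rw [Pi.disjoint_iff]
    intro i
    rw [Prop.disjoint_iff]
    exact fun h => absurd h.1.2 (not_lt.2 h.2)

theorem theorem1 (ν : ℝ) (hν : ∀ k : ℕ, ν ≠ -(k : ℝ)) (x : ℝ) (hx : x ∈ Set.Ioo (0 : ℝ) 1) :
    Tendsto
      (fun n : ℕ =>
        (Set.ncard {μ : ℝ | μ ∈ spectrum ℝ (hilbertLMatrix n ν) ∧ 4 * x < μ ∧ μ < 4} : ℝ) /
          Real.log (n : ℝ))
      atTop
      (𝓝 (1 / (2 * Real.pi) * Real.sqrt ((1 - x) / x))) := by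
  obtain ⟨hx0, hx1⟩ := hx
  have hr : 0 < (1 - x) / x := div_pos (by linarith) hx0
  have hs : 0 < √((1 - x) / x) / 2 := by positivity
  have hμ : 1 / ((√((1 - x) / x) / 2) ^ 2 + 1 / 4) = 4 * x := by
    rw [div_pow, Real.sq_sqrt hr.le]
    field_simp
    ring
  have h := (tendsto_eigenvalueCount_div_log ν hs).sub (tendsto_largeEigenvalueCount_div_log ν)
  rw [hμ, sub_zero, show √((1 - x) / x) / 2 / Real.pi = 1 / (2 * Real.pi) * √((1 - x) / x) by
    field_simp] at h
  refine h.congr fun n => ?_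
  rw [ncard_spectrum_inter n ν _ _ (by linarith),
    ← card_between_add_largeEigenvalueCount ν (by linarith : 4 * x < 4) n]
  push_cast
  ring
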